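/- **Proposition 3.6.** Let $n\ge 1$ be an integer, let $X$ be a topological space and let $x\in X$. Suppose that $X$ is second countable, locally $(n-1)$-connected and $n$-homotopically Hausdorff at $x$, but not semilocally $n$-connected at $x$. Then $\pi_n(X,x)$ is uncountable. Here an $n$-loop at $x$ is a continuous map $\alpha:[0,1]^n\to X$ that sends the boundary $\partial[0,1]^n$ to $x$; homotopies of $n$-loops are taken relative to $\partial[0,1]^n$, and $\alpha$ is essential if it is not homotopic to the constant $n$-loop at $x$. * $X$ is locally $m$-connected if for every $y\in X$ and every open neighbourhood $U$ of $y$ there is an open set $V$ with $y\in V\subseteq U$ such that for all $0\le k\le m$ and all $z\in V$ the inclusion induces the trivial map $\pi_k(V,z)\to\pi_k(U,z)$. * $X$ is $n$-homotopically Hausdorff at $x$ if for every essential $n$-loop $\alpha$ at $x$ there is an open neighbourhood $U$ of $x$ such that $\alpha$ is not homotopic to any $n$-loop at $x$ with image in $U$. * $X$ is semilocally $n$-connected at $x$ if there is an open neighbourhood $U$ of $x$ such that the inclusion induces the trivial homomorphism $\pi_n(U,x)\to\pi_n(X,x)$. -/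

import Mathlib

open scoped Topology Topology.Homotopy unitInterval

/-- The `N`-loop `g ∘ p` in `Y` based at `g x`, for an `N`-loop `p` in `X` based at `x`. -/
def genLoopMap {N X Y : Type*} [TopologicalSpace X] [TopologicalSpace Y] (g : C(X, Y)) {x : X}
    (p : Ω^ N X x) : Ω^ N Y (g x) :=
  ⟨g.comp p.1, fun t ht => congrArg g (p.2 t ht)⟩

theorem genLoopMap_homotopic {N X Y : Type*} [TopologicalSpace X] [TopologicalSpace Y]
    (g : C(X, Y)) {x : X} {p q : Ω^ N X x} (h : GenLoop.Homotopic p q) :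
    GenLoop.Homotopic (genLoopMap g p) (genLoopMap g q) :=
  ContinuousMap.HomotopicRel.comp_continuousMap h g

/-- The map `π_n(X, x) → π_n(Y, g x)` induced by a continuous map `g : X → Y`. -/
def homotopyGroupMap (n : ℕ) {X Y : Type*} [TopologicalSpace X] [TopologicalSpace Y]
    (g : C(X, Y)) (x : X) : π_ n X x → π_ n Y (g x) :=
  Quotient.map (genLoopMap g) (fun _ _ h => genLoopMap_homotopic g h)

/-- The map `g` induces the trivial map on `n`-th homotopy groups (pointed sets for `n = 0`)
based at `x`: every class is sent to the class of the constant `n`-loop. -/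
def IsTrivialOnPi (n : ℕ) {X Y : Type*} [TopologicalSpace X] [TopologicalSpace Y]
    (g : C(X, Y)) (x : X) : Prop :=
  ∀ a : π_ n X x, homotopyGroupMap n g x a = (⟦GenLoop.const⟧ : π_ n Y (g x))

/-- The inclusion of a subset `V` of `X` into a larger subset `U`, as a continuous map. -/
def subsetInclusion {X : Type*} [TopologicalSpace X] {V U : Set X} (h : V ⊆ U) : C(V, U) :=
  ⟨Set.inclusion h, continuous_inclusion h⟩

/-- The inclusion of a subset `U` of `X` into `X`, as a continuous map. -/
def subtypeInclusion {X : Type*} [TopologicalSpace X] (U : Set X) : C(U, X) :=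
  ⟨Subtype.val, continuous_subtype_val⟩

/-- `X` is locally `m`-connected: every open neighbourhood `U` of a point `x` contains an open
neighbourhood `V` of `x` such that, for all `0 ≤ k ≤ m` and all base points `y ∈ V`, the
inclusion induces the trivial map `π_k(V, y) → π_k(U, y)`. For `k = 0` this says that each point
of `V` can be joined to `y` by a path in `U`. Every space that has a basis of `m`-connected open
sets satisfies this. -/
def IsLocallyNConnected (m : ℕ) (X : Type*) [TopologicalSpace X] : Prop :=
  ∀ (x : X) (U : Set X), IsOpen U → x ∈ U →
    ∃ (V : Set X) (hVU : V ⊆ U), IsOpen V ∧ x ∈ V ∧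
      ∀ k ≤ m, ∀ y : V, IsTrivialOnPi k (subsetInclusion hVU) y

/-- `X` is semilocally `n`-connected at `x`: some open neighbourhood `U` of `x` is such that the
inclusion induces the trivial homomorphism `π_n(U, x) → π_n(X, x)`. -/
def IsSemilocallyNConnectedAt (n : ℕ) {X : Type*} [TopologicalSpace X] (x : X) : Prop :=
  ∃ (U : Set X) (hx : x ∈ U), IsOpen U ∧ IsTrivialOnPi n (subtypeInclusion U) ⟨x, hx⟩

/-- `X` is `n`-homotopically Hausdorff at `x`: for each essential `n`-loop `α` at `x` there is an
open neighbourhood `U` of `x` such that `α` is not homotopic, relative to the boundary of the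
cube, to any `n`-loop at `x` lying entirely in `U`. -/
def IsNHomotopicallyHausdorffAt (n : ℕ) {X : Type*} [TopologicalSpace X] (x : X) : Prop :=
  ∀ α : Ω^ (Fin n) X x, ¬ GenLoop.Homotopic α GenLoop.const →
    ∃ U : Set X, IsOpen U ∧ x ∈ U ∧
      ∀ β : Ω^ (Fin n) X x, (∀ t, β t ∈ U) → ¬ GenLoop.Homotopic α β

namespace GenLoop

open Filter

variable {N X : Type*} [TopologicalSpace X] {x : X} [DecidableEq N]

/-! Countably many neighbourhoods `U k` shrink to `x`, each carrying an essential loop `α k`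
(failure of semilocal connectedness), with `U (k + 1)` so small that `α k` does not deform into it
(Hausdorff condition). For each binary sequence, the infinite concatenation of the selected `α k` is
a loop. If two such loops were homotopic, cancelling the factors before the first disagreement `k`
would deform `α k` into `U (k + 1)`. So the binary sequences inject into the group;
`infConcat_eq_transAt` and `uncountable_of_seq` carry this. -/

theorem transAt_apply (i : N) (f g : Ω^ N X x) (t : N → I) :
    transAt i f g t = if (t i : ℝ) ≤ 1 / 2
      then f (Function.update t i <| Set.projIcc 0 1 zero_le_one (2 * t i))
      else g (Function.update t i <| Set.projIcc 0 1 zero_le_one (2 * t i - 1)) :=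
  rfl

theorem transAt_mem (i : N) {f g : Ω^ N X x} {V : Set X} (hf : ∀ t, f t ∈ V) (hg : ∀ t, g t ∈ V)
    (t : N → I) : transAt i f g t ∈ V := by
  rw [transAt_apply]
  split_ifs
  exacts [hf _, hg _]

theorem symmAt_mem (i : N) {f : Ω^ N X x} {V : Set X} (hf : ∀ t, f t ∈ V)
    (t : N → I) : symmAt i f t ∈ V :=
  hf _

theorem coe_projIcc_two_mul_sub_one {s : I} (h : 1 / 2 < (s : ℝ)) :
    (Set.projIcc (0 : ℝ) 1 zero_le_one (2 * s - 1) : ℝ) = 2 * s - 1 := by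
  rw [Set.projIcc_of_mem zero_le_one ⟨by linarith, by linarith [s.2.2]⟩]

/-- The concatenation `β 0 · (β 1 · (⋯ (β (m - 1) · const)))` in direction `i`. -/
noncomputable def finConcat (i : N) : ℕ → (ℕ → Ω^ N X x) → Ω^ N X x
  | 0, _ => const
  | m + 1, β => transAt i (β 0) (finConcat i m fun j => β (j + 1))

/-- Factor `j` lives on the slab between `1 - (1/2)^j` and `1 - (1/2)^(j+1)`, so only the first `m`
factors are seen here. -/
theorem finConcat_stable (i : N) (m : ℕ) : ∀ (m' : ℕ) (β : ℕ → Ω^ N X x) (t : N → I), m ≤ m' →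
    (t i : ℝ) < 1 - (1 / 2) ^ m → finConcat i m' β t = finConcat i m β t := by
  induction m with
  | zero =>
    intro m' β t _ ht
    have := (t i).2.1
    norm_num at ht
    linarith
  | succ m ih =>
    rintro (_ | m') β t hm ht
    · omega
    · simp only [finConcat, transAt_apply]
      split_ifs with h
      · rfl
      · refine ih _ _ _ (by omega) ?_
        rw [Function.update_self, coe_projIcc_two_mul_sub_one (not_le.1 h)]
        rw [pow_succ] at ht
        linarith

theorem finConcat_mem (i : N) {V : Set X} (hx : x ∈ V) (m : ℕ) : ∀ (β : ℕ → Ω^ N X x),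
    (∀ j t, β j t ∈ V) → ∀ t, finConcat i m β t ∈ V := by
  induction m with
  | zero => exact fun _ _ _ => hx
  | succ m ih =>
    exact fun β hβ => transAt_mem i (hβ 0) (ih _ fun j => hβ (j + 1))

theorem finConcat_mem_of_lt (i : N) {V : Set X} (hx : x ∈ V) (m : ℕ) :
    ∀ (M : ℕ) (β : ℕ → Ω^ N X x) (t : N → I), (∀ j ≥ m, ∀ t, β j t ∈ V) →
    1 - (1 / 2) ^ m < (t i : ℝ) → finConcat i M β t ∈ V := by
  induction m with
  | zero => exact fun M β t hβ _ => finConcat_mem i hx M β (fun j => hβ j (Nat.zero_le j)) t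
  | succ m ih =>
    rintro (_ | M) β t hβ ht
    · exact hx
    · rw [pow_succ] at ht
      have hp : (1 / 2 : ℝ) ^ m ≤ 1 := pow_le_one₀ (by norm_num) (by norm_num)
      have h : 1 / 2 < (t i : ℝ) := by linarith
      simp only [finConcat, transAt_apply]
      rw [if_neg (not_le.2 h)]
      refine ih _ _ _ (fun j hj => hβ (j + 1) (by omega)) ?_
      rw [Function.update_self, coe_projIcc_two_mul_sub_one h]
      linarith

open Classical in
/-- The underlying function of the infinite concatenation `β 0 · (β 1 · (β 2 · ⋯))`. -/
noncomputable def infConcatFun (i : N) (β : ℕ → Ω^ N X x) (t : N → I) : X :=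
  if h : ∃ m : ℕ, (t i : ℝ) < 1 - (1 / 2) ^ m then finConcat i h.choose β t else x

theorem infConcatFun_of_lt (i : N) (β : ℕ → Ω^ N X x) {t : N → I} {m : ℕ}
    (h : (t i : ℝ) < 1 - (1 / 2) ^ m) : infConcatFun i β t = finConcat i m β t := by
  have h' : ∃ m : ℕ, (t i : ℝ) < 1 - (1 / 2) ^ m := ⟨m, h⟩
  rw [infConcatFun, dif_pos h', ← finConcat_stable i _ _ β t (le_max_left _ m) h'.choose_spec,
    finConcat_stable i _ _ β t (le_max_right _ m) h]

theorem infConcatFun_of_eq_one (i : N) (β : ℕ → Ω^ N X x) {t : N → I} (h : t i = 1) :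
    infConcatFun i β t = x := by
  refine dif_neg ?_
  rintro ⟨m, hm⟩
  have : (0 : ℝ) < (1 / 2) ^ m := by positivity
  rw [h, Set.Icc.coe_one] at hm
  linarith

theorem eq_one_or_exists_lt (s : I) : s = 1 ∨ ∃ m : ℕ, (s : ℝ) < 1 - (1 / 2) ^ m := by
  rcases eq_or_lt_of_le s.2.2 with h | h
  · exact Or.inl (Subtype.ext h)
  · obtain ⟨m, hm⟩ := exists_pow_lt_of_lt_one (sub_pos.2 h) (by norm_num : (1 / 2 : ℝ) < 1)
    exact Or.inr ⟨m, by linarith⟩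

theorem infConcatFun_mem_of_lt (i : N) {β : ℕ → Ω^ N X x} {V : Set X} (hx : x ∈ V) {m : ℕ}
    (hβ : ∀ j ≥ m, ∀ t, β j t ∈ V) {t : N → I} (ht : 1 - (1 / 2) ^ m < (t i : ℝ)) :
    infConcatFun i β t ∈ V := by
  rcases eq_one_or_exists_lt (t i) with h | ⟨k, hk⟩
  · rwa [infConcatFun_of_eq_one i β h]
  · rw [infConcatFun_of_lt i β hk]
    exact finConcat_mem_of_lt i hx m k β t hβ ht

/-- Away from the face `t i = 1` the function is locally a finite concatenation; at that face the
late factors are small. -/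
theorem continuous_infConcatFun (i : N) {β : ℕ → Ω^ N X x}
    (hβ : ∀ V ∈ 𝓝 x, ∀ᶠ j in atTop, ∀ t, β j t ∈ V) : Continuous (infConcatFun i β) := by
  have hc : Continuous fun t : N → I => (t i : ℝ) := by fun_prop
  refine continuous_iff_continuousAt.2 fun t => ?_
  rcases eq_one_or_exists_lt (t i) with h | ⟨m, hm⟩
  · rw [ContinuousAt, infConcatFun_of_eq_one i β h]
    intro V hV
    obtain ⟨m, hm⟩ := eventually_atTop.1 (hβ V hV)
    have ht : 1 - (1 / 2 : ℝ) ^ m < (t i : ℝ) := by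
      rw [h, Set.Icc.coe_one]
      linarith [show (0 : ℝ) < (1 / 2) ^ m by positivity]
    rw [mem_map]
    filter_upwards [hc.continuousAt.eventually (lt_mem_nhds ht)] with s hs
    exact infConcatFun_mem_of_lt i (mem_of_mem_nhds hV) hm hs
  · refine (finConcat i m β).1.continuous.continuousAt.congr ?_
    filter_upwards [hc.continuousAt.eventually (gt_mem_nhds hm)] with s hs
    exact (infConcatFun_of_lt i β hs).symm

/-- The infinite concatenation `β 0 · (β 1 · (β 2 · ⋯))` in direction `i` of a sequence of
generalized loops whose images converge to the base point. -/
noncomputable def infConcat (i : N) (β : ℕ → Ω^ N X x)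
    (hβ : ∀ V ∈ 𝓝 x, ∀ᶠ j in atTop, ∀ t, β j t ∈ V) : Ω^ N X x :=
  ⟨⟨infConcatFun i β, continuous_infConcatFun i hβ⟩, fun t ht => by
    change infConcatFun i β t = x
    rcases eq_one_or_exists_lt (t i) with h | ⟨m, hm⟩
    · exact infConcatFun_of_eq_one i β h
    · rw [infConcatFun_of_lt i β hm]
      exact boundary _ t ht⟩

theorem infConcat_apply (i : N) (β : ℕ → Ω^ N X x)
    (hβ : ∀ V ∈ 𝓝 x, ∀ᶠ j in atTop, ∀ t, β j t ∈ V) (t : N → I) :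
    infConcat i β hβ t = infConcatFun i β t :=
  rfl

theorem infConcat_mem (i : N) {β : ℕ → Ω^ N X x}
    (hβ : ∀ V ∈ 𝓝 x, ∀ᶠ j in atTop, ∀ t, β j t ∈ V) {V : Set X} (hx : x ∈ V)
    (hV : ∀ j t, β j t ∈ V) (t : N → I) : infConcat i β hβ t ∈ V := by
  rw [infConcat_apply]
  rcases eq_one_or_exists_lt (t i) with h | ⟨k, hk⟩
  · rwa [infConcatFun_of_eq_one i β h]
  · rw [infConcatFun_of_lt i β hk]
    exact finConcat_mem i hx k β hV t

/-- Nesting to the right makes this an equality, not just a homotopy, so the first factor can be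
split off in the group. -/
theorem infConcat_eq_transAt (i : N) {β : ℕ → Ω^ N X x}
    (hβ : ∀ V ∈ 𝓝 x, ∀ᶠ j in atTop, ∀ t, β j t ∈ V)
    (hβ' : ∀ V ∈ 𝓝 x, ∀ᶠ j in atTop, ∀ t, β (j + 1) t ∈ V) :
    infConcat i β hβ = transAt i (β 0) (infConcat i (fun j => β (j + 1)) hβ') := by
  ext t
  rw [infConcat_apply, transAt_apply, infConcat_apply]
  rcases eq_one_or_exists_lt (t i) with h | ⟨m, hm⟩
  · rw [infConcatFun_of_eq_one i β h, h, if_neg (by norm_num), infConcatFun_of_eq_one]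
    rw [Function.update_self]
    ext
    rw [coe_projIcc_two_mul_sub_one (by norm_num)]
    norm_num
  · have hm' : (t i : ℝ) < 1 - (1 / 2) ^ (m + 1) := by
      rw [pow_succ]
      linarith [show (0 : ℝ) < (1 / 2) ^ m by positivity]
    rw [infConcatFun_of_lt i β hm', finConcat, transAt_apply]
    split_ifs with h
    · rfl
    · refine (infConcatFun_of_lt i _ ?_).symm
      rw [Function.update_self, coe_projIcc_two_mul_sub_one (not_le.1 h)]
      rw [pow_succ] at hm'
      linarith

end GenLoop

namespace HomotopyGroup

open GenLoop Filter

variable {N X : Type*} [TopologicalSpace X] {x : X} [DecidableEq N] [Nonempty N]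

/-- Infinite concatenations of two different subsequences of `α` are not homotopic if no `α k` is
homotopic to a loop in a set `U (k + 1)` that contains all later terms. -/
theorem uncountable_of_seq (U : ℕ → Set X) (hU : Antitone U) (hx : ∀ k, x ∈ U k)
    (hb : ∀ V ∈ 𝓝 x, ∃ k, U k ⊆ V) (α : ℕ → Ω^ N X x) (hα : ∀ k t, α k t ∈ U k)
    (hne : ∀ k, ∀ β : Ω^ N X x, (∀ t, β t ∈ U (k + 1)) → ¬ GenLoop.Homotopic (α k) β) :
    Uncountable (HomotopyGroup N X x) := by
  let i : N := Classical.arbitrary N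
  let q : Ω^ N X x → HomotopyGroup N X x := fun f => ⟦f⟧
  -- The group product reverses concatenation, so tails appear on the left below.
  have q_mul : ∀ f g : Ω^ N X x, q f * q g = q (transAt i g f) := fun f g => mul_spec
  have q_inv : ∀ f : Ω^ N X x, (q f)⁻¹ = q (symmAt i f) := fun f => inv_spec
  let β : (ℕ → Bool) → ℕ → Ω^ N X x := fun ε k => if ε k then α k else const
  have hβU : ∀ ε k t, β ε k t ∈ U k := by
    intro ε k t
    by_cases h : ε k = true
    · simpa [β, h] using hα k t
    · simpa [β, h] using hx k
  have hβ : ∀ ε k, ∀ V ∈ 𝓝 x, ∀ᶠ j in atTop, ∀ t, β ε (k + j) t ∈ V := by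
    intro ε k V hV
    obtain ⟨m, hm⟩ := hb V hV
    filter_upwards [eventually_ge_atTop m] with j hj t
    exact hm (hU (by omega) (hβU ε (k + j) t))
  let T : (ℕ → Bool) → ℕ → Ω^ N X x := fun ε k => infConcat i (fun j => β ε (k + j)) (hβ ε k)
  have hTU : ∀ ε k t, T ε k t ∈ U k := fun ε k =>
    infConcat_mem i _ (hx k) fun j t => hU (Nat.le_add_right k j) (hβU ε (k + j) t)
  have hT : ∀ ε k, T ε k = transAt i (β ε k) (T ε (k + 1)) := by
    intro ε k
    have e : (fun j => β ε (k + 1 + j)) = fun j => β ε (k + (j + 1)) := by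
      funext j
      rw [add_assoc, add_comm 1 j]
    simp only [T, e]
    exact infConcat_eq_transAt i (hβ ε k) _
  have hmul : ∀ ε k, q (T ε k) = q (T ε (k + 1)) * q (β ε k) := by
    intro ε k
    rw [hT, q_mul]
  have key : ∀ ε δ k, ε k = true → δ k = false →
      q (T ε k) ≠ q (T δ k) := by
    intro ε δ k hε hδ h
    rw [hmul ε, hmul δ] at h
    have h1 : β ε k = α k := if_pos hε
    have h2 : β δ k = const := if_neg (by simp [hδ])
    -- Solving for `α k` writes it as a concatenation of two tails, both inside `U (k + 1)`.
    rw [h1, h2, show q const = 1 from rfl, mul_one, ← eq_inv_mul_iff_mul_eq, q_inv, q_mul] at h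
    exact hne k _ (transAt_mem i (hTU δ (k + 1)) (symmAt_mem i (hTU ε (k + 1))))
      (Quotient.exact h)
  have hinj : Function.Injective fun ε => q (T ε 0) := by
    intro ε δ h
    have main : ∀ k, (∀ j < k, ε j = δ j) ∧ q (T ε k) = q (T δ k) := by
      intro k
      induction k with
      | zero => exact ⟨fun j hj => absurd hj (Nat.not_lt_zero j), h⟩
      | succ k ih =>
        have hk : ε k = δ k := by
          cases h1 : ε k <;> cases h2 : δ k
          · rfl
          · exact absurd ih.2.symm (key δ ε k h2 h1)
          · exact absurd ih.2 (key ε δ k h1 h2)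
          · rfl
        refine ⟨fun j hj => ?_, ?_⟩
        · rcases Nat.lt_succ_iff_lt_or_eq.1 hj with h | rfl
          exacts [ih.1 j h, hk]
        · have e : β ε k = β δ k := by simp only [β, hk]
          have := ih.2
          rw [hmul ε, hmul δ, e] at this
          exact mul_right_cancel this
    funext k
    exact (main (k + 1)).1 k (Nat.lt_succ_self k)
  have : Uncountable (ℕ → Bool) := by
    rw [← Cardinal.aleph0_lt_mk_iff]
    simpa using Cardinal.cantor Cardinal.aleph0
  exact hinj.uncountable

end HomotopyGroup

/-- A point where `X` is not semilocally `n`-connected has essential `n`-loops in each of its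
neighbourhoods. -/
theorem exists_essential_genLoop_mem {n : ℕ} {X : Type*} [TopologicalSpace X] {x : X}
    (hs : ¬ IsSemilocallyNConnectedAt n x) {U : Set X} (hU : IsOpen U) (hx : x ∈ U) :
    ∃ α : Ω^ (Fin n) X x, (∀ t, α t ∈ U) ∧ ¬ GenLoop.Homotopic α GenLoop.const := by
  by_contra! H
  refine hs ⟨U, hx, hU, fun a => ?_⟩
  induction a using Quotient.inductionOn with
  | h p => exact Quotient.sound (H (genLoopMap (subtypeInclusion U) p) fun t => (p t).2)

theorem proposition3p6 (n : ℕ) (hn : 1 ≤ n) (X : Type*) [TopologicalSpace X]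
    [SecondCountableTopology X] (x : X)
    (hlc : IsLocallyNConnected (n - 1) X)
    (hH : IsNHomotopicallyHausdorffAt n x)
    (hs : ¬ IsSemilocallyNConnectedAt n x) :
    Uncountable (π_ n X x) := by
  have : Nonempty (Fin n) := ⟨⟨0, hn⟩⟩
  obtain ⟨B, hB⟩ := (𝓝 x).exists_antitone_basis
  have step : ∀ (k : ℕ) (U : {U : Set X // IsOpen U ∧ x ∈ U}),
      ∃ (V : {U : Set X // IsOpen U ∧ x ∈ U}) (α : Ω^ (Fin n) X x), V.1 ⊆ U.1 ∧ V.1 ⊆ B k ∧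
        (∀ t, α t ∈ U.1) ∧
        ∀ β : Ω^ (Fin n) X x, (∀ t, β t ∈ V.1) → ¬ GenLoop.Homotopic α β := by
    rintro k ⟨U, hU, hx⟩
    obtain ⟨α, hαU, hα⟩ := exists_essential_genLoop_mem hs hU hx
    obtain ⟨W, hW, hxW, hWα⟩ := hH α hα
    -- `U` gives monotonicity, `W` blocks deforming `α`, and `B k` forces shrinking to `x`.
    exact ⟨⟨U ∩ W ∩ interior (B k), (hU.inter hW).inter isOpen_interior, ⟨hx, hxW⟩,
      mem_interior_iff_mem_nhds.2 (hB.mem k)⟩, α, fun y hy => hy.1.1,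
      fun y hy => interior_subset hy.2, hαU, fun β hβ => hWα β fun t => (hβ t).1.2⟩
  choose V α hVU hVB hαU hα using step
  let U : ℕ → {U : Set X // IsOpen U ∧ x ∈ U} := fun k =>
    Nat.rec ⟨Set.univ, isOpen_univ, Set.mem_univ x⟩ V k
  refine HomotopyGroup.uncountable_of_seq (fun k => (U k).1)
    (antitone_nat_of_succ_le fun k => hVU k (U k)) (fun k => (U k).2.2) (fun W hW => ?_)
    (fun k => α k (U k)) (fun k => hαU k (U k)) fun k => hα k (U k)
  obtain ⟨k, -, hk⟩ := hB.1.mem_iff.1 hW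
  -- `B k` first constrains the set with index `k + 1`.
  exact ⟨k + 1, (hVB k (U k)).trans hk⟩
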